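/- Let $C^\infty(\mathbb{R}^2)$ be the algebra of smooth real functions on $\mathbb{R}^2$ and let $E\subseteq \mathrm{Vect}(\mathbb{R}^2)$ be the $C^\infty(\mathbb{R}^2)$-submodule of the smooth vector fields on $\mathbb{R}^2$ generated by $$v_1 = x\frac{\partial}{\partial x}+y\frac{\partial}{\partial y},\qquad v_2=-y\frac{\partial}{\partial x}+x\frac{\partial}{\partial y};$$ it is free with basis $v_1,v_2$ and satisfies $[E,E]\subseteq E$. For an integer $k\ge 0$ let ${}^E\Omega^k(\mathbb{R}^2)$ be the space of $E$-forms of degree $k$, that is, of alternating $C^\infty(\mathbb{R}^2)$-multilinear maps $\omega: E^k\to C^\infty(\mathbb{R}^2)$ (equivalently, smooth global sections of $\wedge^k({}^ET^*\mathbb{R}^2)$, where ${}^ET\mathbb{R}^2$ is the vector bundle whose sections are the elements of $E$), and let ${}^E\Omega^k(\mathbb{R}^2)=0$ for $k<0$. Let $d:{}^E\Omega^k(\mathbb{R}^2)\to{}^E\Omega^{k+1}(\mathbb{R}^2)$ be the differential $$d\omega(V_0,\dots,V_k)=\sum_i(-1)^iV_i\big(\omega(V_0,\dots,\hat V_i,\dots,V_k)\big)+\sum_{i<j}(-1)^{i+j}\omega\big([V_i,V_j],V_0,\dots,\hat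 V_i,\dots,\hat V_j,\dots,V_k\big).$$ Then the $E$-cohomology ${}^EH^k(\mathbb{R}^2)=\ker\big(d|_{{}^E\Omega^k}\big)/d\big({}^E\Omega^{k-1}\big)$ is, as a real vector space, $${}^EH^k(\mathbb{R}^2)\cong\begin{cases}\mathbb{R}&k=0,\\ \mathbb{R}^2&k=1,\\ \mathbb{R}&k=2,\\ 0&\text{otherwise.}\end{cases}$$ -/

import Mathlib

noncomputable section

set_option linter.unusedSectionVars false
set_option linter.unusedSimpArgs false

/-! ### The complex of alternating forms of a Lie-Rinehart algebra over the reals -/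

namespace LieRinehartForms

variable (A L : Type*) [CommRing A] [LieRing L] [Module A L] [LieRingModule L A]
  [LieRinehartRing A L] [Algebra ℝ A] [LieAlgebra ℝ L] [LieRinehartAlgebra ℝ A L]

/-- Forms of degree `p`: alternating `A`-multilinear maps `L × ⋯ × L → A`. If `A = C^∞(M)` and `L`
is the module of sections of a vector bundle, these are the sections of the `p`-th exterior power
of the dual bundle. -/
abbrev Form (p : ℕ) : Type _ := L [⋀^Fin p]→ₗ[A] A

variable {A L}

/-- `∑_i (-1)^i V_i(ω(V_0, …, V̂_i, …, V_p))`. -/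
def anchorTerm {p : ℕ} (ω : Form A L p) (V : Fin (p + 1) → L) : A :=
  ∑ i : Fin (p + 1), (-1 : ℤ) ^ (i : ℕ) • ⁅V i, ω (i.removeNth V)⁆

/-- `∑_{a < b} (-1)^(a + b) ω([V_a, V_b], V_0, …, V̂_a, …, V̂_b, …, V_p)`, which is an empty sum
for `p = 0`. The pairs `a < b` of indices in `{0, …, p + 1}` are written as `a = i`, `b = j + 1`
with `i ≤ j` in `{0, …, p}`; once `V_a` is removed, `V_b` is the entry with index `j`. -/
def bracketTerm : {p : ℕ} → Form A L p → (Fin (p + 1) → L) → A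
  | 0, _, _ => 0
  | p + 1, ω, V => ∑ i : Fin (p + 1), ∑ j ≥ i, (-1 : ℤ) ^ ((i : ℕ) + ((j : ℕ) + 1)) •
      ω (Matrix.vecCons ⁅V i.castSucc, V j.succ⁆ (j.removeNth (i.castSucc.removeNth V)))

/-- The value of `dω` on `(V_0, …, V_p)`. -/
def koszul {p : ℕ} (ω : Form A L p) (V : Fin (p + 1) → L) : A :=
  anchorTerm ω V + bracketTerm ω V

/-! The next declarations only serve to check that `koszul ω` is a form again: it is
written as a real alternating map, and then shown to be `A`-homogeneous. -/

/-- A form as a real alternating map. -/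
def realForm {p : ℕ} (ω : Form A L p) : L [⋀^Fin p]→ₗ[ℝ] A :=
  { ω.toMultilinearMap.restrictScalars ℝ with map_eq_zero_of_eq' := ω.map_eq_zero_of_eq' }

lemma realForm_apply {p : ℕ} (ω : Form A L p) (V : Fin p → L) : realForm ω V = ω V := rfl

/-- `anchorTerm ω` as a real alternating map. -/
def realAnchor {p : ℕ} (ω : Form A L p) : L [⋀^Fin (p + 1)]→ₗ[ℝ] A :=
  AlternatingMap.alternatizeUncurryFin
    { toFun := fun X => (LieModule.toEnd ℝ L A X).compAlternatingMap (realForm ω)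
      map_add' := fun X Y => by ext; simp
      map_smul' := fun c X => by ext; simp }

lemma realAnchor_apply {p : ℕ} (ω : Form A L p) (V : Fin (p + 1) → L) :
    realAnchor ω V = anchorTerm ω V := by
  simp [realAnchor, anchorTerm, realForm_apply, AlternatingMap.alternatizeUncurryFin_apply]

/-- `(X, Y) ↦ ω([X, Y], ⋯)` with values in real alternating maps. -/
def realBracketAux {p : ℕ} (ω : Form A L (p + 1)) : L →ₗ[ℝ] L →ₗ[ℝ] L [⋀^Fin p]→ₗ[ℝ] A :=
  LinearMap.mk₂ ℝ (fun X Y => (realForm ω).curryLeft ⁅X, Y⁆)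
    (by intros; simp) (by intros; simp) (by intros; simp) (by intros; simp)

lemma realBracketAux_apply {p : ℕ} (ω : Form A L (p + 1)) (X Y : L) (v : Fin p → L) :
    realBracketAux ω X Y v = ω (Matrix.vecCons ⁅X, Y⁆ v) := rfl

/-- `bracketTerm ω` as a real alternating map. -/
def realBracket : {p : ℕ} → Form A L p → L [⋀^Fin (p + 1)]→ₗ[ℝ] A
  | 0, _ => 0
  | _ + 1, ω => (-(1 / 2) : ℝ) • AlternatingMap.alternatizeUncurryFin
      (AlternatingMap.alternatizeUncurryFinLM ∘ₗ realBracketAux ω)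

lemma map_cons_neg {p : ℕ} (ω : Form A L (p + 1)) (X : L) (v : Fin p → L) :
    ω (Matrix.vecCons (-X) v) = - ω (Matrix.vecCons X v) := by
  have := (ω.curryLeft).map_neg X
  exact congrArg (fun f => f v) this

lemma realBracket_apply {p : ℕ} (ω : Form A L p) (V : Fin (p + 1) → L) :
    realBracket ω V = bracketTerm ω V := by
  cases p with
  | zero => rfl
  | succ p =>
    simp only [realBracket, bracketTerm, AlternatingMap.smul_apply,
      AlternatingMap.alternatizeUncurryFin_alternatizeUncurryFinLM_comp_apply, Finset.smul_sum]
    refine Finset.sum_congr rfl fun i _ => Finset.sum_congr rfl fun j _ => ?_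
    rw [realBracketAux_apply, realBracketAux_apply, ← lie_skew (V i.castSucc) (V j.succ),
      map_cons_neg, smul_comm, ← add_assoc, pow_succ, mul_smul]
    congr 1
    module

lemma koszul_eq {p : ℕ} (ω : Form A L p) :
    koszul ω = ⇑(realAnchor ω + realBracket ω) := by
  funext V
  simp [koszul, realAnchor_apply, realBracket_apply]

lemma map_cons_smul {p : ℕ} (ω : Form A L (p + 1)) (a : A) (X : L) (v : Fin p → L) :
    ω (Matrix.vecCons (a • X) v) = a * ω (Matrix.vecCons X v) := by
  have := (ω.curryLeft).map_smul a X
  exact congrArg (fun f => f v) this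

lemma map_cons_add {p : ℕ} (ω : Form A L (p + 1)) (X Y : L) (v : Fin p → L) :
    ω (Matrix.vecCons (X + Y) v) = ω (Matrix.vecCons X v) + ω (Matrix.vecCons Y v) := by
  have := (ω.curryLeft).map_add X Y
  exact congrArg (fun f => f v) this

lemma map_cons_cons_smul {p : ℕ} (ω : Form A L (p + 2)) (a : A) (X Y : L) (v : Fin p → L) :
    ω (Matrix.vecCons Y (Matrix.vecCons (a • X) v)) =
      a * ω (Matrix.vecCons Y (Matrix.vecCons X v)) :=
  map_cons_smul (ω.curryLeft Y) a X v

lemma removeNth_succ_cons {p : ℕ} (k : Fin (p + 1)) (X : L) (v : Fin (p + 1) → L) :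
    k.succ.removeNth (Matrix.vecCons X v : Fin (p + 2) → L) =
      Matrix.vecCons X (k.removeNth v) := by
  funext t
  refine Fin.cases ?_ (fun t => ?_) t <;> simp [Fin.removeNth_apply]

lemma removeNth_zero_cons {p : ℕ} (X : L) (v : Fin p → L) :
    (0 : Fin (p + 1)).removeNth (Matrix.vecCons X v : Fin (p + 1) → L) = v := by
  funext t
  simp [Fin.removeNth_apply]

lemma anchorTerm_cons {p : ℕ} (ω : Form A L (p + 1)) (X : L) (v : Fin (p + 1) → L) :
    anchorTerm ω (Matrix.vecCons X v) = ⁅X, ω v⁆ -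
      ∑ k : Fin (p + 1), (-1 : ℤ) ^ (k : ℕ) • ⁅v k, ω (Matrix.vecCons X (k.removeNth v))⁆ := by
  rw [anchorTerm, Fin.sum_univ_succ, sub_eq_add_neg, ← Finset.sum_neg_distrib]
  simp only [removeNth_succ_cons, removeNth_zero_cons]
  simp [pow_succ]

lemma koszul_cons_smul {p : ℕ} (ω : Form A L p) (a : A) (X : L) (v : Fin p → L) :
    koszul ω (Matrix.vecCons (a • X) v) = a * koszul ω (Matrix.vecCons X v) := by
  cases p with
  | zero => simp [koszul, anchorTerm, bracketTerm, removeNth_zero_cons]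
  | succ p =>
    have hB (Y : L) : bracketTerm ω (Matrix.vecCons Y v) =
        (∑ j : Fin (p + 1), (-1 : ℤ) ^ ((j : ℕ) + 1) •
          ω (Matrix.vecCons ⁅Y, v j⁆ (j.removeNth v))) +
        (bracketTerm ω (Matrix.vecCons Y v) - ∑ j : Fin (p + 1), (-1 : ℤ) ^ ((j : ℕ) + 1) •
          ω (Matrix.vecCons ⁅Y, v j⁆ (j.removeNth v))) := by abel
    have hR : bracketTerm ω (Matrix.vecCons (a • X) v) -
          ∑ j : Fin (p + 1), (-1 : ℤ) ^ ((j : ℕ) + 1) •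
            ω (Matrix.vecCons ⁅a • X, v j⁆ (j.removeNth v)) =
        a * (bracketTerm ω (Matrix.vecCons X v) -
          ∑ j : Fin (p + 1), (-1 : ℤ) ^ ((j : ℕ) + 1) •
            ω (Matrix.vecCons ⁅X, v j⁆ (j.removeNth v))) := by
      have h0 (Y : L) : bracketTerm ω (Matrix.vecCons Y v) -
          ∑ j : Fin (p + 1), (-1 : ℤ) ^ ((j : ℕ) + 1) •
            ω (Matrix.vecCons ⁅Y, v j⁆ (j.removeNth v)) =
          ∑ i : Fin p, ∑ j ≥ i.succ, (-1 : ℤ) ^ (((i.succ : Fin (p + 1)) : ℕ) + ((j : ℕ) + 1)) •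
            ω (Matrix.vecCons ⁅v i.castSucc, v j⁆
              (j.removeNth (i.succ.castSucc.removeNth (Matrix.vecCons Y v)))) := by
        rw [bracketTerm, Fin.sum_univ_succ, sub_eq_iff_eq_add']
        congr 1
        refine Finset.sum_congr (by ext; simp) fun j _ => ?_
        simp [removeNth_zero_cons]
      rw [h0, h0, Finset.mul_sum]
      refine Finset.sum_congr rfl fun i _ => ?_
      rw [Finset.mul_sum]
      refine Finset.sum_congr rfl fun j hj => ?_
      obtain ⟨q, rfl⟩ : ∃ q, p = q + 1 := ⟨p - 1, by have := i.pos; omega⟩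
      obtain ⟨j, rfl⟩ : ∃ j', j = Fin.succ j' := ⟨j.pred (by
        rintro rfl; simp at hj), by simp⟩
      rw [← Fin.succ_castSucc, removeNth_succ_cons, removeNth_succ_cons, removeNth_succ_cons,
        removeNth_succ_cons, map_cons_cons_smul, mul_smul_comm]
    have hS : (∑ j : Fin (p + 1), (-1 : ℤ) ^ ((j : ℕ) + 1) •
          ω (Matrix.vecCons ⁅a • X, v j⁆ (j.removeNth v))) =
        a * (∑ j : Fin (p + 1), (-1 : ℤ) ^ ((j : ℕ) + 1) •
          ω (Matrix.vecCons ⁅X, v j⁆ (j.removeNth v))) +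
        ∑ k : Fin (p + 1), (-1 : ℤ) ^ (k : ℕ) •
          (⁅v k, a⁆ * ω (Matrix.vecCons X (k.removeNth v))) := by
      rw [Finset.mul_sum, ← Finset.sum_add_distrib]
      refine Finset.sum_congr rfl fun j _ => ?_
      rw [← lie_skew (a • X), LieRinehartRing.leibniz_smul_right, map_cons_neg, map_cons_add,
        map_cons_smul, map_cons_smul, ← lie_skew (v j) X, map_cons_neg, pow_succ]
      simp only [mul_neg, mul_one, neg_smul, mul_smul_comm, smul_neg, smul_add]
      ring
    rw [koszul, koszul, hB (a • X), hB X, hR, hS, anchorTerm_cons, anchorTerm_cons]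
    have hT : (∑ k : Fin (p + 1), (-1 : ℤ) ^ (k : ℕ) •
          ⁅v k, ω (Matrix.vecCons (a • X) (k.removeNth v))⁆) =
        a * (∑ k : Fin (p + 1), (-1 : ℤ) ^ (k : ℕ) •
          ⁅v k, ω (Matrix.vecCons X (k.removeNth v))⁆) +
        ∑ k : Fin (p + 1), (-1 : ℤ) ^ (k : ℕ) •
          (⁅v k, a⁆ * ω (Matrix.vecCons X (k.removeNth v))) := by
      rw [Finset.mul_sum, ← Finset.sum_add_distrib]
      refine Finset.sum_congr rfl fun k _ => ?_
      rw [map_cons_smul, LieRinehartRing.leibniz_mul_right, smul_add, smul_eq_mul, mul_smul_comm]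
    rw [hT, LieRinehartRing.lie_smul_eq_mul]
    ring

lemma koszul_update_smul {p : ℕ} (ω : Form A L p) (V : Fin (p + 1) → L) (i : Fin (p + 1))
    (a : A) (X : L) :
    koszul ω (Function.update V i (a • X)) = a * koszul ω (Function.update V i X) := by
  have h (Y : L) : koszul ω (Function.update V i Y) =
      (-1) ^ (i : ℕ) • koszul ω (Matrix.vecCons Y (i.removeNth V)) := by
    rw [koszul_eq, ← Fin.insertNth_removeNth, AlternatingMap.map_insertNth]
  rw [h, h, koszul_cons_smul, mul_smul_comm]

/-- The differential on forms, with
`dω(V_0, …, V_p) = ∑_i (-1)^i V_i(ω(V_0, …, V̂_i, …, V_p))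
  + ∑_{i < j} (-1)^(i + j) ω([V_i, V_j], V_0, …, V̂_i, …, V̂_j, …, V_p)`. -/
def d (p : ℕ) : Form A L p →ₗ[ℝ] Form A L (p + 1) where
  toFun ω :=
    { toFun := koszul ω
      map_update_add' := fun V i X Y => by
        rw [koszul_eq]
        exact (realAnchor ω + realBracket ω).map_update_add V i X Y
      map_update_smul' := fun {inst} V i a X => by
        rw [Subsingleton.elim inst (instDecidableEqFin _)]
        exact koszul_update_smul ω V i a X
      map_eq_zero_of_eq' := fun V i j h hij => by
        rw [koszul_eq]
        exact (realAnchor ω + realBracket ω).map_eq_zero_of_eq V h hij }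
  map_add' ω η := by
    ext V
    change koszul (ω + η) V = koszul ω V + koszul η V
    have hB : bracketTerm (ω + η) V = bracketTerm ω V + bracketTerm η V := by
      cases p <;> simp [bracketTerm, Finset.sum_add_distrib]
    simp only [koszul, hB, anchorTerm, AlternatingMap.add_apply, lie_add, smul_add,
      Finset.sum_add_distrib]
    abel
  map_smul' c ω := by
    ext V
    change koszul (c • ω) V = c • koszul ω V
    have hB : bracketTerm (c • ω) V = c • bracketTerm ω V := by
      cases p <;> simp [bracketTerm, Finset.smul_sum, smul_comm c]
    simp only [koszul, hB, anchorTerm, AlternatingMap.smul_apply, lie_smul, smul_add,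
      Finset.smul_sum, smul_comm c]

variable (A L)

instance (p : ℕ) : AddCommGroup (Form A L p) := AlternatingMap.instAddCommGroup

/-- Closed forms of degree `p`. -/
def closedForms (p : ℕ) : Submodule ℝ (Form A L p) := LinearMap.ker (d p)

/-- Exact forms of degree `p`; only `0` is exact in degree `0`. -/
def exactForms : (p : ℕ) → Submodule ℝ (Form A L p)
  | 0 => ⊥
  | p + 1 => LinearMap.range (d p)

/-- The cohomology in degree `p`: closed forms modulo exact forms. -/
abbrev Cohomology (p : ℕ) : Type _ :=
  closedForms A L p ⧸ (exactForms A L p).submoduleOf (closedForms A L p)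

end LieRinehartForms

/-! ### Smooth functions and vector fields on the plane -/

namespace EllipticPlane

open scoped Manifold ContDiff

open VectorField

/-- The plane `ℝ²`; the coordinates of a point `q` are `x = q 0` and `y = q 1`. -/
abbrev Plane : Type := EuclideanSpace ℝ (Fin 2)

/-- The algebra `C^∞(ℝ²)`. -/
abbrev SmoothFun : Type := C^∞⟮𝓘(ℝ, Plane), Plane; 𝓘(ℝ, ℝ), ℝ⟯

/-- The `C^∞(ℝ²)`-module `Vect(ℝ²)` of smooth vector fields, with pointwise operations. -/
abbrev Vect : Type := C^∞⟮𝓘(ℝ, Plane), Plane; 𝓘(ℝ, Plane), Plane⟯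

lemma SmoothFun.contDiff (f : SmoothFun) : ContDiff ℝ ∞ (f : Plane → ℝ) :=
  contMDiff_iff_contDiff.1 f.contMDiff

lemma Vect.contDiff (V : Vect) : ContDiff ℝ ∞ (V : Plane → Plane) :=
  contMDiff_iff_contDiff.1 V.contMDiff

lemma SmoothFun.differentiableAt (f : SmoothFun) (q : Plane) :
    DifferentiableAt ℝ (f : Plane → ℝ) q :=
  (SmoothFun.contDiff f).differentiable (by simp) q

lemma Vect.differentiableAt (V : Vect) (q : Plane) :
    DifferentiableAt ℝ (V : Plane → Plane) q :=
  (Vect.contDiff V).differentiable (by simp) q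

lemma minSmoothness_two_le : minSmoothness ℝ 2 ≤ ∞ := by
  rw [minSmoothness_of_isRCLikeNormedField]
  exact WithTop.coe_le_coe.2 le_top

/-- The Lie bracket of vector fields. -/
instance : Bracket Vect Vect where
  bracket V W := ⟨lieBracket ℝ V W, contMDiff_iff_contDiff.2
    ((Vect.contDiff V).lieBracket_vectorField (Vect.contDiff W) (by simp))⟩

lemma lie_apply (V W : Vect) (q : Plane) : ⁅V, W⁆ q = lieBracket ℝ V W q := rfl

/-- The derivative `V(f)` of a function along a vector field. -/
instance : Bracket Vect SmoothFun where
  bracket V f := ⟨fun q => fderiv ℝ f q (V q), contMDiff_iff_contDiff.2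
    (((SmoothFun.contDiff f).fderiv_right (m := ∞) (by simp)).clm_apply (Vect.contDiff V))⟩

lemma lie_fun_apply (V : Vect) (f : SmoothFun) (q : Plane) : ⁅V, f⁆ q = fderiv ℝ f q (V q) := rfl

instance : LieRing Vect where
  add_lie U V W := by
    ext1 q
    exact lieBracket_add_left (Vect.differentiableAt U q) (Vect.differentiableAt V q)
  lie_add U V W := by
    ext1 q
    exact lieBracket_add_right (Vect.differentiableAt V q) (Vect.differentiableAt W q)
  lie_self U := by
    ext1 q
    exact congrFun (lieBracket_self (𝕜 := ℝ) (V := (U : Plane → Plane))) q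
  leibniz_lie U V W := by
    ext1 q
    exact leibniz_identity_lieBracket (n := ∞) minSmoothness_two_le (Vect.contDiff U).contDiffAt
      (Vect.contDiff V).contDiffAt (Vect.contDiff W).contDiffAt

instance : LieAlgebra ℝ Vect where
  lie_smul c V W := by
    ext1 q
    exact lieBracket_const_smul_right (Vect.differentiableAt W q)

instance : LieRingModule Vect SmoothFun where
  add_lie V W f := by
    ext1 q
    exact map_add (fderiv ℝ f q) (V q) (W q)
  lie_add V f g := by
    ext1 q
    change fderiv ℝ (⇑f + ⇑g) q (V q) = fderiv ℝ f q (V q) + fderiv ℝ g q (V q)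
    rw [fderiv_add (SmoothFun.differentiableAt f q) (SmoothFun.differentiableAt g q)]
    rfl
  leibniz_lie V W f := by
    ext1 q
    have h := fderiv_apply_lieBracket (𝕜 := ℝ) (n := ∞) (x := q)
      (SmoothFun.contDiff f).contDiffAt minSmoothness_two_le
      (Vect.differentiableAt W q) (Vect.differentiableAt V q)
    change fderiv ℝ (fun r => fderiv ℝ f r (W r)) q (V q) =
      fderiv ℝ f q (lieBracket ℝ V W q) + fderiv ℝ (fun r => fderiv ℝ f r (V r)) q (W q)
    rw [h]
    abel

instance : LieRinehartRing SmoothFun Vect where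
  lie_smul_eq_mul' a b V := by
    ext1 q
    exact map_smul (fderiv ℝ b q) (a q) (V q)
  leibniz_mul_right' V a b := by
    ext1 q
    change fderiv ℝ (⇑a * ⇑b) q (V q) = a q * fderiv ℝ b q (V q) + fderiv ℝ a q (V q) * b q
    rw [fderiv_mul (SmoothFun.differentiableAt a q) (SmoothFun.differentiableAt b q)]
    simp [mul_comm]
  leibniz_smul_right' V W a := by
    ext1 q
    change lieBracket ℝ V (fun r => a r • W r) q =
      a q • lieBracket ℝ V W q + fderiv ℝ a q (V q) • W q
    rw [lieBracket_smul_right (SmoothFun.differentiableAt a q) (Vect.differentiableAt W q)]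
    abel

instance : LieRinehartAlgebra ℝ SmoothFun Vect where
  smul_assoc c a V := by
    ext1 q
    exact smul_assoc c (a q) (V q)
  smul_lie c V f := by
    ext1 q
    exact map_smul (fderiv ℝ f q) c (V q)
  lie_smul c V f := by
    ext1 q
    change fderiv ℝ (c • ⇑f) q (V q) = c • fderiv ℝ f q (V q)
    rw [fderiv_const_smul (SmoothFun.differentiableAt f q)]
    rfl

/-! ### The elliptic structure -/

/-- The dilation `x ∂/∂x + y ∂/∂y`. -/
def v₁ : Vect := ⟨fun q => !₂[q 0, q 1], contMDiff_iff_contDiff.2 (by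
  rw [contDiff_euclidean]; intro i; fin_cases i <;> simp <;> fun_prop)⟩

/-- The rotation `-y ∂/∂x + x ∂/∂y`. -/
def v₂ : Vect := ⟨fun q => !₂[-q 1, q 0], contMDiff_iff_contDiff.2 (by
  rw [contDiff_euclidean]; intro i; fin_cases i <;> simp <;> fun_prop)⟩

lemma lie_v₁_v₂ : ⁅v₁, v₂⁆ = 0 := by
  let J : Plane →ₗ[ℝ] Plane :=
    { toFun := fun q => !₂[-q 1, q 0]
      map_add' := fun q r => by ext i; fin_cases i <;> simp [add_comm]
      map_smul' := fun c q => by ext i; fin_cases i <;> simp }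
  have h₁ : (v₁ : Plane → Plane) = id := by
    funext q; ext i; fin_cases i <;> rfl
  have h₂ : (v₂ : Plane → Plane) = LinearMap.toContinuousLinearMap J := rfl
  ext1 q
  rw [lie_apply, lieBracket, h₁, h₂, fderiv_id, ContinuousLinearMap.fderiv]
  exact sub_self _

/-- The `C^∞(ℝ²)`-submodule of `Vect(ℝ²)` generated by `v₁` and `v₂`, which is involutive. -/
def E : LieRinehartSubalgebra SmoothFun Vect where
  toSubmodule := Submodule.span SmoothFun {v₁, v₂}
  lie_mem' {V W} hV hW := by
    have hS (X Y : Vect) (a : SmoothFun) (hY : Y ∈ Submodule.span SmoothFun {v₁, v₂})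
        (hXY : ⁅X, Y⁆ ∈ Submodule.span SmoothFun {v₁, v₂}) :
        ⁅X, a • Y⁆ ∈ Submodule.span SmoothFun {v₁, v₂} := by
      rw [LieRinehartRing.leibniz_smul_right]
      exact add_mem (Submodule.smul_mem _ _ hXY) (Submodule.smul_mem _ _ hY)
    have h₁ : v₁ ∈ Submodule.span SmoothFun {v₁, v₂} := Submodule.subset_span (by simp)
    have h₂ : v₂ ∈ Submodule.span SmoothFun {v₁, v₂} := Submodule.subset_span (by simp)
    have h₂₁ : ⁅v₂, v₁⁆ = 0 := by rw [← lie_skew, lie_v₁_v₂, neg_zero]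
    have hG (X : Vect) (hX₁ : ⁅X, v₁⁆ ∈ Submodule.span SmoothFun {v₁, v₂})
        (hX₂ : ⁅X, v₂⁆ ∈ Submodule.span SmoothFun {v₁, v₂}) (Y : Vect)
        (hY : Y ∈ Submodule.span SmoothFun {v₁, v₂}) :
        ⁅X, Y⁆ ∈ Submodule.span SmoothFun {v₁, v₂} := by
      obtain ⟨a, b, rfl⟩ := Submodule.mem_span_pair.1 hY
      rw [lie_add]
      exact add_mem (hS X v₁ a h₁ hX₁) (hS X v₂ b h₂ hX₂)
    refine hG V ?_ ?_ W hW
    · rw [← lie_skew]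
      exact neg_mem (hG v₁ (by simp) (by simp [lie_v₁_v₂]) V hV)
    · rw [← lie_skew]
      exact neg_mem (hG v₂ (by simp [h₂₁]) (by simp) V hV)

/-- The `E`-cohomology of the plane. As `E` is free on `v₁` and `v₂`, the alternating
`C^∞(ℝ²)`-multilinear maps `E × ⋯ × E → C^∞(ℝ²)` of degree `k` are exactly the global sections of
the `k`-th exterior power of the `E`-cotangent bundle. -/
abbrev ECohomology (k : ℕ) : Type := LieRinehartForms.Cohomology SmoothFun E k

end EllipticPlane
end

noncomputable section

open scoped Manifold ContDiff Topology

/-! ### Smoothness of parametric integrals -/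

universe u

/-! The fields `v₁` and `v₂` commute and are a basis of `E`. In this frame the complex is therefore
`f ↦ (v₁ f, v₂ f)` followed by `(a, b) ↦ v₁ b - v₂ a`, with nothing above degree 2. Both fields
vanish at the origin, so the frame coefficients of an exact form vanish there. Forms with constant
coefficients are closed and realise every value at the origin. It remains to see that a closed form
whose coefficients vanish at the origin is exact.

This rests on one analytic fact: on smooth functions the radial derivative `v₁` has only constants
in its kernel (`apply_eq_of_lie_v₁_eq_zero`), and its image is all functions vanishing at the origin
(`exists_lie_v₁_eq`). Degree 0 uses the kernel and degree 2 the image. In degree 1, take `f` with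
`v₁ f = a`; closedness and commutation give `v₁ (v₂ f - b) = 0`, so `v₂ f - b` is constant, and its
value at the origin is 0.

For the image, the solution of `v₁ g = f` is the integral of `f(t x) / t` over `0 ≤ t ≤ 1`.
Hadamard's lemma removes the singularity at `t = 0`, and smoothness of parametric integrals makes
`g` smooth. -/

lemma hasFDerivAt_intervalIntegral_of_contDiff {H G : Type u} [NormedAddCommGroup H]
    [NormedSpace ℝ H] [FiniteDimensional ℝ H] [NormedAddCommGroup G] [NormedSpace ℝ G]
    [CompleteSpace G] {F : H → ℝ → G} (hF : ContDiff ℝ 1 (Function.uncurry F)) (a b : ℝ) (x : H) :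
    HasFDerivAt (fun y => ∫ t in a..b, F y t)
      (∫ t in a..b, (fderiv ℝ (Function.uncurry F) (x, t)).comp
        (ContinuousLinearMap.inl ℝ H ℝ)) x := by
  have hF' : Continuous fun p : H × ℝ => (fderiv ℝ (Function.uncurry F) p).comp
      (ContinuousLinearMap.inl ℝ H ℝ) :=
    (hF.continuous_fderiv one_ne_zero).clm_comp continuous_const
  have hc (y : H) : Continuous (F y) :=
    hF.continuous.comp (by fun_prop : Continuous fun t => (y, t))
  -- Finite dimension makes the closed ball compact, so a constant dominates the partial derivative.
  obtain ⟨C, hC⟩ := ((isCompact_closedBall x 1).prod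
    (isCompact_uIcc (a := a) (b := b))).exists_bound_of_continuousOn hF'.continuousOn
  refine intervalIntegral.hasFDerivAt_integral_of_dominated_of_fderiv_le
    (F' := fun y t => (fderiv ℝ (Function.uncurry F) (y, t)).comp (ContinuousLinearMap.inl ℝ H ℝ))
    (bound := fun _ => C)
    (Metric.closedBall_mem_nhds x one_pos)
    (Filter.Eventually.of_forall fun y => (hc y).aestronglyMeasurable)
    ((hc x).intervalIntegrable a b)
    (hF'.comp (by fun_prop : Continuous fun t => (x, t))).aestronglyMeasurable
    (Filter.Eventually.of_forall fun t ht y hy =>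
      hC (y, t) ⟨hy, Set.uIoc_subset_uIcc ht⟩)
    intervalIntegrable_const
    (Filter.Eventually.of_forall fun t _ y _ => ?_)
  have h := (hF.differentiable one_ne_zero (y, t)).hasFDerivAt
  exact HasFDerivAt.comp (f := fun z => (z, t)) y h (hasFDerivAt_prodMk_left y t)

/-- Each differentiation under the integral replaces `G` by `H →L[ℝ] G`. The induction therefore
quantifies over `G`, and `H` and `G` share a universe so that the new target is admissible. -/
lemma contDiff_intervalIntegral_of_contDiff {H : Type u} [NormedAddCommGroup H]
    [NormedSpace ℝ H] [FiniteDimensional ℝ H] (a b : ℝ) (n : ℕ) :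
    ∀ {G : Type u} [NormedAddCommGroup G] [NormedSpace ℝ G] [CompleteSpace G] {F : H → ℝ → G},
      ContDiff ℝ n (Function.uncurry F) → ContDiff ℝ n fun y => ∫ t in a..b, F y t := by
  induction n with
  | zero =>
    intro G _ _ _ F hF
    exact contDiff_zero.2 (intervalIntegral.continuous_parametric_intervalIntegral_of_continuous
      hF.continuous continuous_const)
  | succ n ih =>
    intro G _ _ _ F hF
    have h := hasFDerivAt_intervalIntegral_of_contDiff (hF.of_le (by norm_cast; omega)) a b
    push_cast at hF ⊢
    refine contDiff_succ_iff_fderiv.2 ⟨fun x => (h x).differentiableAt, by simp, ?_⟩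
    rw [funext fun x => (h x).fderiv]
    exact ih (F := fun x t => (fderiv ℝ (Function.uncurry F) (x, t)).comp
      (ContinuousLinearMap.inl ℝ H ℝ)) ((hF.fderiv_right le_rfl).clm_comp contDiff_const)

/-! ### Integration along rays from the origin -/

/-- The average of a function over the segment from the origin to a point. -/
def rayAverage {H G : Type*} [NormedAddCommGroup H] [NormedSpace ℝ H] [NormedAddCommGroup G]
    [NormedSpace ℝ G] (g : H → G) (x : H) : G :=
  ∫ t in (0 : ℝ)..1, g (t • x)

section RayAverage

variable {H G : Type*} [NormedAddCommGroup H] [NormedSpace ℝ H] [NormedAddCommGroup G]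
  [NormedSpace ℝ G]

lemma hasDerivAt_comp_smul {f : H → G} (hf : Differentiable ℝ f) (x : H) (t : ℝ) :
    HasDerivAt (fun s : ℝ => f (s • x)) (fderiv ℝ f (t • x) x) t := by
  have h : HasDerivAt (fun s : ℝ => s • x) x t := by
    simpa using (hasDerivAt_id t).smul_const x
  exact (hf (t • x)).hasFDerivAt.comp_hasDerivAt t h

/-- A differentiable function with vanishing radial derivative is constant. -/
lemma eq_apply_zero_of_fderiv_apply_self_eq_zero {f : H → ℝ} (hf : Differentiable ℝ f)
    (h : ∀ x, fderiv ℝ f x x = 0) (x : H) : f x = f 0 := by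
  have hcont : Continuous fun s : ℝ => f (s • x) := hf.continuous.comp (by fun_prop)
  obtain ⟨c, ⟨hc, -⟩, hslope⟩ := exists_hasDerivAt_eq_slope (fun s : ℝ => f (s • x)) _ one_pos
    hcont.continuousOn fun t _ => hasDerivAt_comp_smul hf x t
  -- The hypothesis at `c • x` gives `c` times this derivative, and the mean value point satisfies
  -- `c > 0`.
  have h0 : fderiv ℝ f (c • x) x = 0 := by
    have := h (c • x)
    rw [map_smul, smul_eq_mul] at this
    exact (mul_eq_zero.1 this).resolve_left hc.ne'
  rw [h0] at hslope
  simpa [sub_eq_zero] using hslope.symm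

lemma rayAverage_apply {g : H → H →L[ℝ] G} (hg : Continuous g) (x y : H) :
    rayAverage g x y = ∫ t in (0 : ℝ)..1, g (t • x) y :=
  ContinuousLinearMap.intervalIntegral_apply
    (Continuous.intervalIntegrable (hg.comp (by fun_prop : Continuous fun t : ℝ => t • x)) 0 1) y

variable [CompleteSpace G]

/-- Hadamard's lemma. -/
lemma rayAverage_fderiv_apply_self {f : H → G} (hf : ContDiff ℝ ∞ f) (x : H) :
    rayAverage (fderiv ℝ f) x x = f x - f 0 := by
  have hc : Continuous (fderiv ℝ f) := hf.continuous_fderiv (by simp)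
  have hcx : Continuous fun t : ℝ => fderiv ℝ f (t • x) x :=
    (hc.comp (by fun_prop : Continuous fun t : ℝ => t • x)).clm_apply continuous_const
  rw [rayAverage_apply hc, intervalIntegral.integral_eq_sub_of_hasDerivAt
    (fun t _ => hasDerivAt_comp_smul (hf.differentiable (by simp)) x t)
    (hcx.intervalIntegrable 0 1)]
  simp

end RayAverage

/-! ### Inverting the radial derivative -/

section RadialDerivative

variable {H G : Type u} [NormedAddCommGroup H] [NormedSpace ℝ H] [FiniteDimensional ℝ H]
  [NormedAddCommGroup G] [NormedSpace ℝ G] [CompleteSpace G]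

lemma contDiff_rayAverage {g : H → G} (hg : ContDiff ℝ ∞ g) : ContDiff ℝ ∞ (rayAverage g) :=
  contDiff_iff_forall_nat_le.2 fun m _ => contDiff_intervalIntegral_of_contDiff 0 1 m
    (F := fun x t => g (t • x))
    ((hg.of_le (by exact_mod_cast le_top)).comp (contDiff_snd.smul contDiff_fst))

/-- A smooth function vanishing at the origin is the radial derivative of a smooth function. -/
lemma exists_contDiff_fderiv_apply_self_eq {f : H → G} (hf : ContDiff ℝ ∞ f) (h0 : f 0 = 0) :
    ∃ g : H → G, ContDiff ℝ ∞ g ∧ ∀ x, fderiv ℝ g x x = f x := by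
  -- By Hadamard's lemma and `h0`, `f x = K x x`. Hence `f (t • x) / t` equals `K (t • x) x` for `t
  -- ≠ 0`, which is smooth up to `t = 0`; its integral over `[0, 1]` is the witness.
  set K := rayAverage (fderiv ℝ f) with hK
  have hKs : ContDiff ℝ ∞ K := contDiff_rayAverage (hf.fderiv_right (by simp))
  have hgs : ContDiff ℝ ∞ fun x => rayAverage K x x :=
    (contDiff_rayAverage hKs).clm_apply contDiff_id
  refine ⟨fun x => rayAverage K x x, hgs, fun x => ?_⟩
  have hc : Continuous fun t : ℝ => K (t • x) x :=
    (hKs.continuous.comp (by fun_prop : Continuous fun t : ℝ => t • x)).clm_apply continuous_const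
  -- Rescaling turns the dilation factor into the upper limit of integration, so the radial
  -- derivative at `x` follows from the fundamental theorem of calculus at `s = 1`.
  have hscale (s : ℝ) : rayAverage K (s • x) (s • x) = ∫ t in (0 : ℝ)..s, K (t • x) x := by
    have := intervalIntegral.smul_integral_comp_mul_right (a := 0) (b := 1)
      (fun t => K (t • x) x) s
    rw [zero_mul, one_mul] at this
    rw [rayAverage_apply hKs.continuous, ← this, ← intervalIntegral.integral_smul]
    simp [mul_smul]
  have h₁ := hasDerivAt_comp_smul (hgs.differentiable (by simp)) x 1
  have h₂ : HasDerivAt (fun s : ℝ => rayAverage K (s • x) (s • x)) (K ((1 : ℝ) • x) x) 1 := by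
    rw [funext hscale]
    exact intervalIntegral.integral_hasDerivAt_right (hc.intervalIntegrable 0 1)
      (hc.stronglyMeasurableAtFilter _ _) hc.continuousAt
  have h := h₁.unique h₂
  rwa [one_smul, hK, rayAverage_fderiv_apply_self hf, h0, sub_zero] at h

end RadialDerivative

end

noncomputable section

/-! ### Forms of a Lie-Rinehart algebra that is free of rank two -/

namespace LieRinehartForms

section Forms

variable {A L : Type*} [CommRing A] [LieRing L] [Module A L]

lemma exists_form_zero (a : A) : ∃ ω : Form A L 0, ω ![] = a :=
  ⟨AlternatingMap.constOfIsEmpty A L (Fin 0) a, rfl⟩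

lemma form_zero_ext {ω η : Form A L 0} (h : ω ![] = η ![]) : ω = η := by
  ext v
  rwa [Subsingleton.elim v ![]]

/-- An alternating map is determined by its values on families of distinct basis vectors, and two
basis vectors cannot fill three or more slots. -/
lemma form_eq_zero_of_three_le (e : Module.Basis (Fin 2) A L) {k : ℕ} (hk : 3 ≤ k)
    (ω : Form A L k) : ω = 0 :=
  e.ext_alternating fun v hv => by
    have := Fintype.card_le_of_injective v hv
    simp only [Fintype.card_fin] at this
    omega

lemma form_one_ext (e : Module.Basis (Fin 2) A L) {ω η : Form A L 1}
    (h : ∀ i, ω ![e i] = η ![e i]) : ω = η :=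
  e.ext_alternating fun v _ => by
    have hv : (fun i => e (v i)) = ![e (v 0)] := by
      funext i; fin_cases i; rfl
    rw [hv, h]

lemma form_two_ext (e : Module.Basis (Fin 2) A L) {ω η : Form A L 2}
    (h : ω ![e 0, e 1] = η ![e 0, e 1]) : ω = η := by
  have he : ![e 0, e 1] = e := by funext i; fin_cases i <;> rfl
  rw [he] at h
  rw [ω.eq_smul_basis_det e, η.eq_smul_basis_det e, h]

lemma exists_form_one (e : Module.Basis (Fin 2) A L) (a b : A) :
    ∃ ω : Form A L 1, ω ![e 0] = a ∧ ω ![e 1] = b := by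
  refine ⟨AlternatingMap.ofSubsingleton A L A (0 : Fin 1) (e.constr A ![a, b]), ?_, ?_⟩ <;>
  simp

lemma exists_form_two (e : Module.Basis (Fin 2) A L) (c : A) :
    ∃ ω : Form A L 2, ω ![e 0, e 1] = c := by
  have he : ![e 0, e 1] = e := by funext i; fin_cases i <;> rfl
  exact ⟨c • e.det, by simp [he, e.det_self]⟩

end Forms

variable {A L : Type*} [CommRing A] [LieRing L] [Module A L] [LieRingModule L A]
  [LieRinehartRing A L] [Algebra ℝ A] [LieAlgebra ℝ L] [LieRinehartAlgebra ℝ A L]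

/-- A linear map on forms that is surjective on closed forms, and whose kernel in the closed forms
consists of the exact ones, computes the cohomology. -/
lemma nonempty_cohomology_equiv {p : ℕ} {W : Type*} [AddCommGroup W] [Module ℝ W]
    (φ : Form A L p →ₗ[ℝ] W) (hsurj : ∀ w, ∃ ω ∈ closedForms A L p, φ ω = w)
    (hker : ∀ ω ∈ closedForms A L p, φ ω = 0 ↔ ω ∈ exactForms A L p) :
    Nonempty (Cohomology A L p ≃ₗ[ℝ] W) := by
  have hs : Function.Surjective (φ.domRestrict (closedForms A L p)) := fun w => by
    obtain ⟨ω, hω, h⟩ := hsurj w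
    exact ⟨⟨ω, hω⟩, h⟩
  have hk : (exactForms A L p).submoduleOf (closedForms A L p) =
      LinearMap.ker (φ.domRestrict (closedForms A L p)) := by
    ext ω
    exact (hker ω ω.2).symm
  exact ⟨(Submodule.quotEquivOfEq _ _ hk).trans (LinearMap.quotKerEquivOfSurjective _ hs)⟩

lemma d_zero_apply (ω : Form A L 0) (X : L) : d 0 ω ![X] = ⁅X, ω ![]⁆ := by
  change koszul ω ![X] = _
  simp [koszul, anchorTerm, bracketTerm]

lemma d_one_apply (ω : Form A L 1) (X Y : L) :
    d 1 ω ![X, Y] = ⁅X, ω ![Y]⁆ - ⁅Y, ω ![X]⁆ - ω ![⁅X, Y⁆] := by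
  change koszul ω ![X, Y] = _
  rw [koszul, anchorTerm_cons]
  have h (v : Fin 0 → L) : v = ![] := Subsingleton.elim _ _
  simp [bracketTerm, h, sub_eq_add_neg]

end LieRinehartForms

/-! ### The cohomology of the elliptic structure -/

namespace EllipticPlane

open LieRinehartForms
lemma v₁_apply (q : Plane) : v₁ q = q := by
  ext i; fin_cases i <;> rfl

lemma lie_v₁_apply_zero (f : SmoothFun) : ⁅v₁, f⁆ (0 : Plane) = 0 := by
  rw [lie_fun_apply, v₁_apply, map_zero]

lemma lie_v₂_apply_zero (f : SmoothFun) : ⁅v₂, f⁆ (0 : Plane) = 0 := by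
  have : v₂ (0 : Plane) = 0 := by ext i; fin_cases i <;> simp [v₂]
  rw [lie_fun_apply, this, map_zero]

/-- As `v₁` is the identity field, differentiating along it is the radial derivative. -/
lemma exists_lie_v₁_eq {f : SmoothFun} (h0 : f 0 = 0) : ∃ g : SmoothFun, ⁅v₁, g⁆ = f := by
  obtain ⟨g, hg, h⟩ := exists_contDiff_fderiv_apply_self_eq (SmoothFun.contDiff f) h0
  let G : SmoothFun := ⟨g, contMDiff_iff_contDiff.2 hg⟩
  refine ⟨G, ?_⟩
  ext1 q
  rw [lie_fun_apply, v₁_apply]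
  exact h q

lemma apply_eq_of_lie_v₁_eq_zero {f : SmoothFun} (h : ⁅v₁, f⁆ = 0) (q : Plane) : f q = f 0 := by
  refine eq_apply_zero_of_fderiv_apply_self_eq_zero
    ((SmoothFun.contDiff f).differentiable (by simp)) (fun x => ?_) q
  have := DFunLike.congr_fun h x
  rwa [lie_fun_apply, v₁_apply] at this

lemma lie_algebraMap (V : Vect) (c : ℝ) : ⁅V, algebraMap ℝ SmoothFun c⁆ = 0 := by
  ext1 q
  rw [lie_fun_apply]
  change fderiv ℝ (fun _ : Plane => c) q (V q) = 0
  simp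

lemma algebraMap_apply (c : ℝ) (q : Plane) : algebraMap ℝ SmoothFun c q = c := rfl

/-- The determinant of `v₁, v₂` is `x² + y²`, so they are independent away from the origin.
Continuity carries the vanishing of the coefficients over to the origin. -/
lemma eq_zero_of_smul_add_smul_eq_zero {f g : SmoothFun} (h : f • v₁ + g • v₂ = 0) :
    f = 0 ∧ g = 0 := by
  have hq (q : Plane) : f q * q 0 - g q * q 1 = 0 ∧ f q * q 1 + g q * q 0 = 0 := by
    have h' : f q • v₁ q + g q • v₂ q = 0 := DFunLike.congr_fun h q
    have h0 := congrArg (fun w : Plane => w 0) h'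
    have h1 := congrArg (fun w : Plane => w 1) h'
    simp [v₁, v₂] at h0 h1
    exact ⟨by linarith, h1⟩
  have hne (q : Plane) (hq0 : q ≠ 0) : f q = 0 ∧ g q = 0 := by
    obtain ⟨h1, h2⟩ := hq q
    have hr : q 0 ^ 2 + q 1 ^ 2 ≠ 0 := fun hr => hq0 <| by
      have h0 : q 0 = 0 := by nlinarith [sq_nonneg (q 0), sq_nonneg (q 1)]
      have h1 : q 1 = 0 := by nlinarith [sq_nonneg (q 0), sq_nonneg (q 1)]
      ext i; fin_cases i <;> simp [h0, h1]
    -- Cramer's rule: the linear combinations isolate each coefficient times the determinant.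
    exact ⟨(mul_eq_zero.1 (show f q * (q 0 ^ 2 + q 1 ^ 2) = 0 by
        linear_combination q 0 * h1 + q 1 * h2)).resolve_right hr,
      (mul_eq_zero.1 (show g q * (q 0 ^ 2 + q 1 ^ 2) = 0 by
        linear_combination q 0 * h2 - q 1 * h1)).resolve_right hr⟩
  have hext (k : SmoothFun) (hk : ∀ q : Plane, q ≠ 0 → k q = 0) : k = 0 := by
    have := Continuous.ext_on (dense_compl_singleton (0 : Plane)) (SmoothFun.contDiff k).continuous
      (continuous_const (y := (0 : ℝ))) fun q hq => hk q hq
    ext1 q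
    exact congrFun this q
  exact ⟨hext f fun q hq0 => (hne q hq0).1, hext g fun q hq0 => (hne q hq0).2⟩

/-- `v₁` as an element of `E`. -/
def e₁ : E := ⟨v₁, Submodule.subset_span (by simp)⟩

/-- `v₂` as an element of `E`. -/
def e₂ : E := ⟨v₂, Submodule.subset_span (by simp)⟩

lemma lie_e₁_e₂ : ⁅e₁, e₂⁆ = 0 := Subtype.ext lie_v₁_v₂

/-- The module `E` is free with basis `v₁`, `v₂`. -/
def basisE : Module.Basis (Fin 2) SmoothFun E :=
  Module.Basis.mk (v := ![e₁, e₂])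
    (by
      rw [LinearIndependent.pair_iff]
      intro f g h
      exact eq_zero_of_smul_add_smul_eq_zero (congrArg (Subtype.val : E → Vect) h))
    (by
      rintro ⟨V, hV⟩ -
      obtain ⟨a, b, h⟩ := Submodule.mem_span_pair.1 hV
      rw [Matrix.range_cons, Matrix.range_cons, Matrix.range_empty, Set.union_empty,
        Set.singleton_union]
      exact Submodule.mem_span_pair.2 ⟨a, b, Subtype.ext h⟩)

lemma basisE_zero : basisE 0 = e₁ := by simp [basisE]

lemma basisE_one : basisE 1 = e₂ := by simp [basisE]

lemma form_one_ext_iff {ω η : Form SmoothFun E 1} :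
    ω = η ↔ ω ![e₁] = η ![e₁] ∧ ω ![e₂] = η ![e₂] := by
  refine ⟨fun h => by simp [h], fun h => form_one_ext basisE fun i => ?_⟩
  fin_cases i
  · simpa [basisE_zero] using h.1
  · simpa [basisE_one] using h.2

lemma form_two_ext_iff {ω η : Form SmoothFun E 2} :
    ω = η ↔ ω ![e₁, e₂] = η ![e₁, e₂] := by
  refine ⟨fun h => by simp [h], fun h => form_two_ext basisE ?_⟩
  rwa [basisE_zero, basisE_one]

/-! ### The differential in the frame -/

lemma d_zero_e₁ (ω : Form SmoothFun E 0) : d 0 ω ![e₁] = ⁅v₁, ω ![]⁆ := d_zero_apply ω e₁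

lemma d_zero_e₂ (ω : Form SmoothFun E 0) : d 0 ω ![e₂] = ⁅v₂, ω ![]⁆ := d_zero_apply ω e₂

lemma d_one_e₁_e₂ (ω : Form SmoothFun E 1) :
    d 1 ω ![e₁, e₂] = ⁅v₁, ω ![e₂]⁆ - ⁅v₂, ω ![e₁]⁆ := by
  have h0 : ω ![0] = 0 := ω.map_coord_zero (0 : Fin 1) rfl
  rw [d_one_apply, lie_e₁_e₂, h0, sub_zero]
  rfl

lemma mem_closedForms_zero {ω : Form SmoothFun E 0} :
    ω ∈ closedForms SmoothFun E 0 ↔ ⁅v₁, ω ![]⁆ = 0 ∧ ⁅v₂, ω ![]⁆ = 0 := by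
  rw [closedForms, LinearMap.mem_ker, form_one_ext_iff, d_zero_e₁, d_zero_e₂]
  rfl

lemma mem_closedForms_one {ω : Form SmoothFun E 1} :
    ω ∈ closedForms SmoothFun E 1 ↔ ⁅v₁, ω ![e₂]⁆ = ⁅v₂, ω ![e₁]⁆ := by
  rw [closedForms, LinearMap.mem_ker, form_two_ext_iff, d_one_e₁_e₂, ← sub_eq_zero (a := ⁅v₁, _⁆)]
  rfl

lemma mem_closedForms_two (ω : Form SmoothFun E 2) : ω ∈ closedForms SmoothFun E 2 :=
  form_eq_zero_of_three_le basisE le_rfl _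

/-- The value of a form on given elements of `E`, at the origin. -/
def evalAt {k : ℕ} (V : Fin k → E) : Form SmoothFun E k →ₗ[ℝ] ℝ where
  toFun ω := ω V (0 : Plane)
  map_add' _ _ := rfl
  map_smul' _ _ := rfl

lemma evalAt_apply {k : ℕ} (V : Fin k → E) (ω : Form SmoothFun E k) :
    evalAt V ω = ω V (0 : Plane) := rfl

/-! ### Cohomology in each degree -/

theorem nonempty_ECohomology_zero_equiv : Nonempty (ECohomology 0 ≃ₗ[ℝ] ℝ) := by
  refine nonempty_cohomology_equiv (evalAt ![]) (fun c => ?_) fun ω hω => ?_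
  · obtain ⟨ω, hω⟩ := exists_form_zero (L := E) (algebraMap ℝ SmoothFun c)
    refine ⟨ω, mem_closedForms_zero.2 ?_, ?_⟩
    · rw [hω]
      exact ⟨lie_algebraMap _ _, lie_algebraMap _ _⟩
    · rw [evalAt_apply, hω, algebraMap_apply]
  · rw [evalAt_apply, exactForms, Submodule.mem_bot]
    refine ⟨fun h => form_zero_ext ?_, fun h => by rw [h]; rfl⟩
    ext1 q
    rw [apply_eq_of_lie_v₁_eq_zero (mem_closedForms_zero.1 hω).1, h]
    rfl

theorem nonempty_ECohomology_one_equiv : Nonempty (ECohomology 1 ≃ₗ[ℝ] (Fin 2 → ℝ)) := by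
  refine nonempty_cohomology_equiv (LinearMap.pi ![evalAt ![e₁], evalAt ![e₂]]) (fun c => ?_)
    fun ω hω => ?_
  · obtain ⟨ω, h₁, h₂⟩ := exists_form_one basisE (algebraMap ℝ SmoothFun (c 0))
      (algebraMap ℝ SmoothFun (c 1))
    rw [basisE_zero] at h₁
    rw [basisE_one] at h₂
    refine ⟨ω, mem_closedForms_one.2 ?_, ?_⟩
    · rw [h₁, h₂, lie_algebraMap, lie_algebraMap]
    · funext i
      fin_cases i
      · simp [evalAt_apply, h₁, algebraMap_apply]
      · simp [evalAt_apply, h₂, algebraMap_apply]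
  · have hclosed := mem_closedForms_one.1 hω
    constructor
    · intro h
      have h₁ : ω ![e₁] (0 : Plane) = 0 := congrFun h 0
      have h₂ : ω ![e₂] (0 : Plane) = 0 := congrFun h 1
      obtain ⟨f, hf⟩ := exists_lie_v₁_eq h₁
      obtain ⟨η, hη⟩ := exists_form_zero (L := E) f
      refine ⟨η, form_one_ext_iff.2 ⟨by rw [d_zero_e₁, hη, hf], ?_⟩⟩
      rw [d_zero_e₂, hη, ← sub_eq_zero]
      -- Since `v₁` and `v₂` commute, `v₁ (v₂ f) = v₂ (v₁ f)`, which closedness identifies with `v₁`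
      -- of the second coefficient.
      have hconst : ⁅v₁, ⁅v₂, f⁆ - ω ![e₂]⁆ = 0 := by
        rw [lie_sub, leibniz_lie, lie_v₁_v₂, zero_lie, zero_add, hf, hclosed, sub_self]
      ext1 q
      rw [apply_eq_of_lie_v₁_eq_zero hconst]
      change ⁅v₂, f⁆ (0 : Plane) - ω ![e₂] (0 : Plane) = 0
      rw [lie_v₂_apply_zero, h₂, sub_zero]
    · rintro ⟨η, rfl⟩
      funext i
      fin_cases i
      · exact (DFunLike.congr_fun (d_zero_e₁ η) 0).trans (lie_v₁_apply_zero _)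
      · exact (DFunLike.congr_fun (d_zero_e₂ η) 0).trans (lie_v₂_apply_zero _)

theorem nonempty_ECohomology_two_equiv : Nonempty (ECohomology 2 ≃ₗ[ℝ] ℝ) := by
  refine nonempty_cohomology_equiv (evalAt ![e₁, e₂]) (fun c => ?_) fun ω _ => ?_
  · obtain ⟨ω, h⟩ := exists_form_two basisE (algebraMap ℝ SmoothFun c)
    rw [basisE_zero, basisE_one] at h
    exact ⟨ω, mem_closedForms_two ω, by rw [evalAt_apply, h, algebraMap_apply]⟩
  · constructor
    · intro h
      obtain ⟨f, hf⟩ := exists_lie_v₁_eq h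
      -- With first coefficient 0 the differential reduces to `v₁ f`, so inverting `v₁` is enough.
      obtain ⟨η, h₁, h₂⟩ := exists_form_one basisE 0 f
      rw [basisE_zero] at h₁
      rw [basisE_one] at h₂
      exact ⟨η, form_two_ext_iff.2 (by rw [d_one_e₁_e₂, h₁, h₂, lie_zero, sub_zero, hf])⟩
    · rintro ⟨η, rfl⟩
      rw [evalAt_apply, d_one_e₁_e₂]
      change ⁅v₁, η ![e₂]⁆ (0 : Plane) - ⁅v₂, η ![e₁]⁆ (0 : Plane) = 0
      rw [lie_v₁_apply_zero, lie_v₂_apply_zero, sub_zero]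

theorem subsingleton_ECohomology {k : ℕ} (hk : 3 ≤ k) : Subsingleton (ECohomology k) := by
  have : Subsingleton (closedForms SmoothFun E k) := ⟨fun ω η => Subtype.ext <| by
    rw [form_eq_zero_of_three_le basisE hk ω.1, form_eq_zero_of_three_le basisE hk η.1]⟩
  exact (Submodule.mkQ_surjective _).subsingleton

end EllipticPlane
end

theorem mainTheorem4 :
    Nonempty (EllipticPlane.ECohomology 0 ≃ₗ[ℝ] ℝ) ∧
    Nonempty (EllipticPlane.ECohomology 1 ≃ₗ[ℝ] (Fin 2 → ℝ)) ∧
    Nonempty (EllipticPlane.ECohomology 2 ≃ₗ[ℝ] ℝ) ∧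
    ∀ k : ℕ, 3 ≤ k → Subsingleton (EllipticPlane.ECohomology k) :=
  ⟨EllipticPlane.nonempty_ECohomology_zero_equiv, EllipticPlane.nonempty_ECohomology_one_equiv,
    EllipticPlane.nonempty_ECohomology_two_equiv,
    fun _ hk => EllipticPlane.subsingleton_ECohomology hk⟩
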